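/- Let $\mathcal H=\mathcal G_1*_{\mathcal U}\mathcal G_2$ be the free product of two groups $\mathcal G_1,\mathcal G_2$ with amalgamated subgroup $\mathcal U$ (embedded in $\mathcal G_1$ and in $\mathcal G_2$ by injective homomorphisms; $\mathcal G_1$, $\mathcal G_2$, $\mathcal U$ are identified with their images in $\mathcal H$). For a group $G$ with a finite generating set $S$, let $\Gamma(G,S)$ be the Cayley graph with its path metric $|x-y|$, in which $g$ and $gs$ ($g\in G$, $s\in S$) are joined by an edge of length $1$. The group $G$ is called hyperbolic if it has a finite generating set $S$ for which $\Gamma(G,S)$ is a hyperbolic metric space, i.e. there is $\delta\ge 0$ such that $(x\cdot y)_o\ge\min((x\cdot z)_o,(y\cdot z)_o)-\delta$ for all points $x,y,z,o$, where $(x\cdot y)_o=\frac12(|x-o|+|y-o|-|x-y|)$. A subgroup $K\le G$ is called quasiconvex in $G$ (with respect to $S$) if there is $\varepsilon\ge 0$ such that every geodesic segment of $\Gamma(G,S)$ with endpoints in $K$ lies in the $\varepsilon$-neighbourhood of $K$. Theorem 6. Suppose that $\mathcal H$ is hyperbolic and let $S$ be any finite generating set of $\mathcal H$. If $\mathcal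 U$ is quasiconvex in $\mathcal H$ (with respect to $S$), then $\mathcal G_1$ and $\mathcal G_2$ are quasiconvex in $\mathcal H$ (with respect to $S$), and $\mathcal G_1$ and $\mathcal G_2$ are hyperbolic groups. -/

import Mathlib

/-- The Gromov product `(x · y)_o = (|x - o| + |y - o| - |x - y|) / 2` of two vertices of a graph,
based at the vertex `o`, for the path metric of the graph. -/
noncomputable def gromovProduct {V : Type*} (Γ : SimpleGraph V) (o x y : V) : ℝ :=
  ((Γ.dist x o : ℝ) + (Γ.dist y o : ℝ) - (Γ.dist x y : ℝ)) / 2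

/-- A connected graph is hyperbolic if for some `δ ≥ 0` the four-point inequality
`(x · y)_o ≥ min ((x · z)_o) ((y · z)_o) - δ` holds. It is imposed on the vertices: every point of
the geometric realization is within `1/2` of a vertex, so this is the same as hyperbolicity of the
realization (for a possibly larger `δ`). Connectedness makes the path metric a genuine metric. -/
def IsHyperbolicGraph {V : Type*} (Γ : SimpleGraph V) : Prop :=
  Γ.Connected ∧ ∃ δ : ℝ, 0 ≤ δ ∧ ∀ o x y z : V,
    min (gromovProduct Γ o x z) (gromovProduct Γ o y z) - δ ≤ gromovProduct Γ o x y

/-- A set `Y` of vertices is quasiconvex if there is `ε ≥ 0` such that every vertex of every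
geodesic edge path with both ends in `Y` is at distance at most `ε` from some point of `Y`. -/
def IsQuasiconvexIn {V : Type*} (Γ : SimpleGraph V) (Y : Set V) : Prop :=
  ∃ ε : ℝ, 0 ≤ ε ∧ ∀ y₁ ∈ Y, ∀ y₂ ∈ Y, ∀ p : Γ.Walk y₁ y₂, p.length = Γ.dist y₁ y₂ →
    ∀ w ∈ p.support, ∃ y ∈ Y, (Γ.dist w y : ℝ) ≤ ε

/-- A group is (word-)hyperbolic if it has a finite generating set whose Cayley graph (edges
joining `g` and `g * s`) is a hyperbolic metric space. -/
def IsHyperbolicGroup (G : Type*) [Group G] : Prop :=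
  ∃ S : Set G, S.Finite ∧ Subgroup.closure S = ⊤ ∧ IsHyperbolicGraph (SimpleGraph.mulCayley S)

/-- The subgroup `U` of `G` is quasiconvex with respect to the generating set `S` of `G`: its set
of elements is quasiconvex in the Cayley graph of `G` over `S`. -/
def IsQuasiconvexSubgroup {G : Type*} [Group G] (S : Set G) (U : Subgroup G) : Prop :=
  IsQuasiconvexIn (SimpleGraph.mulCayley S) (U : Set G)

/-! In the Bass–Serre picture, removing the vertex `G i` from the tree leaves translates, by
elements of `G i`, of half-trees (`HalfTree`). Multiplying by a fixed generator can leave a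
half-tree only by passing through `U` at one of finitely many prefixes (`exists_finite_prefixes`),
so every Cayley edge crossing its boundary has its inner end within a uniform distance of `U`. A
geodesic with ends in `G i` that visits `g` times a half-tree must enter it and leave it. The
portion inside therefore has both ends near `g U`; since `U` is quasiconvex and the graph
hyperbolic, the whole portion stays near `g U`, which is contained in `G i`. This is
`isQuasiconvexSubgroup_range_of`. A quasiconvex subgroup is generated by its elements in a large
enough ball, and its inclusion is then bi-Lipschitz. Its hyperbolicity, like independence of the
finite generating set, follows from `IsHyperbolicGraph.of_biLipschitz`: the Morse lemma gives slim
triangles in the source, and slim triangles give back the four-point inequality. -/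

/-- `c 0, …, c n` are the successive vertices of a geodesic edge path from `x` to `y`. -/
structure IsGeodesicSeq {V : Type*} (Γ : SimpleGraph V) (c : ℕ → V) (n : ℕ) (x y : V) : Prop where
  start : c 0 = x
  finish : c n = y
  dist_add : ∀ i j, i ≤ j → j ≤ n → Γ.dist (c i) (c j) + i = j

/-- The four-point inequality with constant `D`, in terms of distances. -/
def FourPoint {V : Type*} (Γ : SimpleGraph V) (D : ℕ) : Prop :=
  ∀ x y z o : V, Γ.dist x y + Γ.dist z o ≤ Γ.dist x z + Γ.dist y o + D ∨
    Γ.dist x y + Γ.dist z o ≤ Γ.dist y z + Γ.dist x o + D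

/-- Geodesic triangles are `T`-slim. -/
def SlimTriangles {V : Type*} (Γ : SimpleGraph V) (T : ℕ) : Prop :=
  ∀ (x y z : V) (c a b : ℕ → V) (n k l : ℕ), IsGeodesicSeq Γ c n x y → IsGeodesicSeq Γ a k x z →
    IsGeodesicSeq Γ b l z y → ∀ i ≤ n,
      (∃ j ≤ k, Γ.dist (c i) (a j) ≤ T) ∨ ∃ j ≤ l, Γ.dist (c i) (b j) ≤ T

/-! ### Geodesic sequences. -/

section Geodesics

variable {V : Type*} {Γ : SimpleGraph V}

theorem IsGeodesicSeq.length_eq {c : ℕ → V} {n : ℕ} {x y : V} (h : IsGeodesicSeq Γ c n x y) :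
    Γ.dist x y = n := by
  have := h.dist_add 0 n (Nat.zero_le n) le_rfl
  rw [h.start, h.finish] at this
  omega

theorem IsGeodesicSeq.dist_start {c : ℕ → V} {n : ℕ} {x y : V} (h : IsGeodesicSeq Γ c n x y)
    {i : ℕ} (hi : i ≤ n) : Γ.dist x (c i) = i := by
  have := h.dist_add 0 i (Nat.zero_le i) hi
  rw [h.start] at this
  omega

theorem IsGeodesicSeq.dist_finish {c : ℕ → V} {n : ℕ} {x y : V} (h : IsGeodesicSeq Γ c n x y)
    {i : ℕ} (hi : i ≤ n) : Γ.dist (c i) y + i = n := by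
  have := h.dist_add i n hi le_rfl
  rwa [h.finish] at this

theorem IsGeodesicSeq.subpath {c : ℕ → V} {n : ℕ} {x y : V} (h : IsGeodesicSeq Γ c n x y)
    {a b : ℕ} (hab : a ≤ b) (hb : b ≤ n) :
    IsGeodesicSeq Γ (fun i => c (a + i)) (b - a) (c a) (c b) where
  start := rfl
  finish := by simp [Nat.add_sub_cancel' hab]
  dist_add i j hij hj := by
    have := h.dist_add (a + i) (a + j) (by omega) (by omega)
    omega

theorem dist_comp_le_of_adj {W : Type*} {Γ' : SimpleGraph W} (hΓ : Γ'.Connected) {c : ℕ → W}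
    {K n : ℕ} (h : ∀ i < n, Γ'.dist (c i) (c (i + 1)) ≤ K) :
    ∀ i j, i ≤ j → j ≤ n → Γ'.dist (c i) (c j) ≤ K * (j - i) := by
  intro i j hij
  induction j, hij using Nat.le_induction with
  | base => simp
  | succ j hij ih =>
    intro hj
    have h1 := ih (by omega)
    have h2 := h j (by omega)
    have h3 := hΓ.dist_triangle (u := c i) (v := c j) (w := c (j + 1))
    have : j + 1 - i = (j - i) + 1 := by omega
    rw [this, Nat.mul_succ]
    omega

/-- Each of the three pieces cut off by `i` and `j` is at most its number of steps, and the total is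
the distance of the ends; the triangle inequality forces equality. -/
theorem SimpleGraph.Walk.isGeodesicSeq (hΓ : Γ.Connected) {x y : V} (p : Γ.Walk x y)
    (hp : p.length = Γ.dist x y) : IsGeodesicSeq Γ p.getVert p.length x y where
  start := p.getVert_zero
  finish := p.getVert_length
  dist_add i j hij hj := by
    have key := dist_comp_le_of_adj hΓ (c := p.getVert) (K := 1) (n := p.length)
      fun i hi => (SimpleGraph.dist_eq_one_iff_adj.2 (p.adj_getVert_succ hi)).le
    have h1 := key 0 i (by omega) (by omega)
    have h2 := key i j hij hj
    have h3 := key j p.length hj le_rfl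
    have h4 := hΓ.dist_triangle (u := p.getVert 0) (v := p.getVert i) (w := p.getVert j)
    have h5 := hΓ.dist_triangle (u := p.getVert 0) (v := p.getVert j) (w := p.getVert p.length)
    rw [p.getVert_length] at h3 h5
    rw [p.getVert_zero] at h1 h4 h5
    omega

theorem exists_isGeodesicSeq (hΓ : Γ.Connected) (x y : V) :
    ∃ (c : ℕ → V) (n : ℕ), IsGeodesicSeq Γ c n x y := by
  obtain ⟨p, hp⟩ := hΓ.exists_walk_length_eq_dist x y
  exact ⟨_, _, p.isGeodesicSeq hΓ hp⟩

end Geodesics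

/-! ### The four-point inequality in natural numbers. -/

section FourPoint

variable {V : Type*} {Γ : SimpleGraph V}

/-- Doubling clears the denominators, and the common distance to `o` cancels from either term of the
minimum; hence `D ≥ 2 * δ`. -/
theorem IsHyperbolicGraph.exists_fourPoint (h : IsHyperbolicGraph Γ) : ∃ D, FourPoint Γ D := by
  obtain ⟨-, δ, hδ, h⟩ := h
  obtain ⟨D, hD⟩ := exists_nat_ge (2 * δ)
  refine ⟨D, fun x y z o => ?_⟩
  have := h o x y z
  simp only [gromovProduct] at this
  rcases le_total (((Γ.dist x o : ℝ) + Γ.dist z o - Γ.dist x z) / 2)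
    (((Γ.dist y o : ℝ) + Γ.dist z o - Γ.dist y z) / 2) with h' | h'
  · rw [min_eq_left h'] at this
    left
    have : (Γ.dist x y : ℝ) + Γ.dist z o ≤ Γ.dist x z + Γ.dist y o + D := by linarith
    exact_mod_cast this
  · rw [min_eq_right h'] at this
    right
    have : (Γ.dist x y : ℝ) + Γ.dist z o ≤ Γ.dist y z + Γ.dist x o + D := by linarith
    exact_mod_cast this

theorem FourPoint.isHyperbolicGraph (hΓ : Γ.Connected) {D : ℕ} (h : FourPoint Γ D) :
    IsHyperbolicGraph Γ := by
  refine ⟨hΓ, D, by positivity, fun o x y z => ?_⟩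
  simp only [gromovProduct]
  have hD : (0 : ℝ) ≤ D := by positivity
  rcases h x y z o with h | h
  · have h' : (Γ.dist x y : ℝ) + Γ.dist z o ≤ Γ.dist x z + Γ.dist y o + D := by exact_mod_cast h
    refine (sub_le_sub_right (min_le_left _ _) _).trans ?_
    linarith
  · have h' : (Γ.dist x y : ℝ) + Γ.dist z o ≤ Γ.dist y z + Γ.dist x o + D := by exact_mod_cast h
    refine (sub_le_sub_right (min_le_right _ _) _).trans ?_
    linarith

/-- Along a chain of at most `2 ^ k` steps, some step has Gromov product at `w` not much larger
than that of the ends of the chain. -/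
theorem FourPoint.exists_step {D : ℕ} (h : FourPoint Γ D) (x : ℕ → V) (w : V) (k : ℕ) :
    ∀ a n, 1 ≤ n → n ≤ 2 ^ k → ∃ i, a ≤ i ∧ i < a + n ∧
      Γ.dist (x i) w + Γ.dist (x (i + 1)) w + Γ.dist (x a) (x (a + n)) ≤
        Γ.dist (x a) w + Γ.dist (x (a + n)) w + Γ.dist (x i) (x (i + 1)) + k * D := by
  induction k with
  | zero =>
    intro a n h1 h2
    obtain rfl : n = 1 := by simp at h2; omega
    exact ⟨a, le_rfl, by omega, by omega⟩
  | succ k ih =>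
    intro a n h1 h2
    rw [pow_succ] at h2
    rw [Nat.succ_mul]
    by_cases hn : n = 1
    · subst hn
      exact ⟨a, le_rfl, by omega, by omega⟩
    obtain ⟨m, l, rfl, hm, hl⟩ : ∃ m l, n = m + l ∧ (1 ≤ m ∧ m ≤ 2 ^ k) ∧ 1 ≤ l ∧ l ≤ 2 ^ k :=
      ⟨n / 2, n - n / 2, by omega, by omega, by omega⟩
    obtain ⟨i, hi, hi', H⟩ := ih a m hm.1 hm.2
    obtain ⟨j, hj, hj', H'⟩ := ih (a + m) l hl.1 hl.2
    rw [add_assoc a m l] at H'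
    -- At the midpoint of the chain, one half has Gromov product at `w` at most `D / 2` above that
    -- of the whole; each halving costs one `D` in doubled form.
    rcases h (x a) (x (a + (m + l))) (x (a + m)) w with h' | h'
    · exact ⟨i, hi, by omega, by omega⟩
    · rw [Γ.dist_comm (u := x (a + (m + l))) (v := x (a + m))] at h'
      exact ⟨j, by omega, by omega, by omega⟩

/-- The distance of a point to a geodesic is bounded by the Gromov product of its ends. -/
theorem FourPoint.exists_dist_geodesic_le {D : ℕ} (hΓ : Γ.Connected) (h : FourPoint Γ D)
    {c : ℕ → V} {n : ℕ} {x y : V} (hc : IsGeodesicSeq Γ c n x y) (w : V) :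
    ∃ i ≤ n, 2 * Γ.dist w (c i) + Γ.dist x y ≤ Γ.dist x w + Γ.dist y w + 2 * D + 1 := by
  have hn := hc.length_eq
  have h1 := hΓ.dist_triangle (u := x) (v := y) (w := w)
  have h2 := hΓ.dist_triangle (u := y) (v := x) (w := w)
  have h3 := hΓ.dist_triangle (u := x) (v := w) (w := y)
  rw [Γ.dist_comm (u := w) (v := y)] at h3
  rw [Γ.dist_comm (u := y) (v := x)] at h2
  -- At this position, the Gromov product of `w` and `y` at `x`, both alternatives of the four-point
  -- inequality give the same bound up to rounding.
  obtain ⟨t, ht⟩ : ∃ t, t = (Γ.dist x w + n - Γ.dist y w) / 2 := ⟨_, rfl⟩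
  have htn : t ≤ n := by omega
  refine ⟨t, htn, ?_⟩
  have h4 := hc.dist_start htn
  have h5 := hc.dist_finish htn
  rw [Γ.dist_comm] at h5
  rw [Γ.dist_comm (u := w)]
  rcases h x y (c t) w with h' | h' <;> omega

end FourPoint

/-! ### The Morse lemma for quasigeodesics. -/

section Morse

/-- Taking for `k` the logarithm of `6 * K * N + 2`, a linear quantity in `N` is bounded by a
logarithmic one. In the Morse lemma `N` is the deviation and `6 * K * N + 2` bounds the number of
steps of a detour. -/
theorem exists_bound_of_log_growth (K D : ℕ) :
    ∃ R, ∀ N, (∀ k, 6 * K * N + 2 ≤ 2 ^ k → 2 * N ≤ K + k * D) → N ≤ R := by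
  obtain ⟨A, hA⟩ : ∃ A, A = 6 * K * K + 4 := ⟨_, rfl⟩
  obtain ⟨B, hB⟩ : ∃ B, B = 6 * K * D := ⟨_, rfl⟩
  refine ⟨K + (A + B + 4) * D, fun N h => ?_⟩
  have hk := h (Nat.clog 2 (6 * K * N + 2)) (Nat.le_pow_clog one_lt_two _)
  have hk' := Nat.pow_pred_clog_lt_self one_lt_two (x := 6 * K * N + 2) (by omega)
  have hpos : 0 < Nat.clog 2 (6 * K * N + 2) := Nat.clog_pos one_lt_two (by omega)
  generalize Nat.clog 2 (6 * K * N + 2) = k at *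
  obtain ⟨k, rfl⟩ : ∃ l, k = l + 1 := ⟨k - 1, by omega⟩
  simp only [Nat.pred_eq_sub_one, Nat.add_sub_cancel] at hk'
  have hpow : 2 ^ (k + 1) < A + B * (k + 1) := by
    have : 6 * K * (2 * N) ≤ 6 * K * (K + (k + 1) * D) := Nat.mul_le_mul_left _ hk
    rw [pow_succ, hA, hB]
    nlinarith
  have hbound : k + 1 ≤ A + B + 4 := by
    by_contra hlt
    have hsq : (k + 1) ^ 2 ≤ 2 ^ (k + 1) := by
      have : ∀ m, 4 ≤ m → m ^ 2 ≤ 2 ^ m := by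
        intro m hm
        induction m, hm using Nat.le_induction with
        | base => norm_num
        | succ m hm ih => rw [pow_succ 2 m]; nlinarith
      exact this _ (by omega)
    nlinarith
  have := Nat.mul_le_mul_right D hbound
  omega

variable {V W : Type*} {Γ : SimpleGraph V} {Γ' : SimpleGraph W}

/-- A geodesic stays close to every quasigeodesic sequence with the same ends. -/
theorem FourPoint.exists_geodesic_near_quasigeodesic (hΓ : Γ'.Connected) {D : ℕ}
    (h : FourPoint Γ' D) (K : ℕ) :
    ∃ R, ∀ (F g : ℕ → W) (n L : ℕ) (x y : W), F 0 = x → F n = y →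
      (∀ i < n, Γ'.dist (F i) (F (i + 1)) ≤ K) →
      (∀ i j, i ≤ j → j ≤ n → j ≤ K * Γ'.dist (F i) (F j) + i) →
      IsGeodesicSeq Γ' g L x y → ∀ t ≤ L, ∃ i ≤ n, Γ'.dist (g t) (F i) ≤ R := by
  classical
  obtain ⟨R, hR⟩ := exists_bound_of_log_growth K D
  refine ⟨R, fun F g n L x y hx hy hK hF hg => ?_⟩
  have hex : ∃ N, ∀ t ≤ L, ∃ i ≤ n, Γ'.dist (g t) (F i) ≤ N :=
    ⟨L, fun t ht => ⟨0, Nat.zero_le n, by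
      rw [hx, Γ'.dist_comm, hg.dist_start ht]; exact ht⟩⟩
  -- `N` is the exact largest deviation of `g` from `F`; minimality supplies a point `g t` at
  -- distance at least `N` from all of `F`.
  obtain ⟨N, hN, hmin⟩ : ∃ N, (∀ t ≤ L, ∃ i ≤ n, Γ'.dist (g t) (F i) ≤ N) ∧
      ∀ M < N, ¬ ∀ t ≤ L, ∃ i ≤ n, Γ'.dist (g t) (F i) ≤ M :=
    ⟨Nat.find hex, Nat.find_spec hex, fun M hM => Nat.find_min hex hM⟩
  suffices hNR : N ≤ R from fun t ht => (hN t ht).imp fun i hi => ⟨hi.1, hi.2.trans hNR⟩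
  refine hR N fun k hk => ?_
  rcases Nat.eq_zero_or_pos N with rfl | hNpos
  · simp
  have hfar := hmin (N - 1) (by omega)
  push Not at hfar
  obtain ⟨t, htL, hfar⟩ := hfar
  replace hfar : ∀ i ≤ n, N ≤ Γ'.dist (F i) (g t) := fun i hi => by
    have := hfar i hi
    rw [Γ'.dist_comm] at this
    omega
  -- Step back `2 * N` along `g`, or to its start, then jump to a nearest part of `F`. The last
  -- condition says that the Gromov product of this jump's ends at `g t` is at least `N`.
  obtain ⟨a, hat, hata, i, hi, hia, hiN⟩ : ∃ a ≤ t, t ≤ a + 2 * N ∧ ∃ i ≤ n,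
      Γ'.dist (g a) (F i) ≤ N ∧
      Γ'.dist (g a) (F i) + 2 * N ≤ Γ'.dist (g a) (g t) + Γ'.dist (F i) (g t) := by
    by_cases h2 : 2 * N ≤ t
    · obtain ⟨i, hi, hiN⟩ := hN (t - 2 * N) (by omega)
      have := hfar i hi
      have h3 := hg.dist_add (t - 2 * N) t (by omega) htL
      exact ⟨t - 2 * N, by omega, by omega, i, hi, hiN, by omega⟩
    · have := hfar 0 (Nat.zero_le n)
      refine ⟨0, Nat.zero_le t, by omega, 0, Nat.zero_le n, ?_⟩
      rw [hg.start, ← hx, Γ'.dist_self]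
      omega
  obtain ⟨b, hbL, htb, hbt, j, hj, hjb, hjN⟩ : ∃ b ≤ L, t ≤ b ∧ b ≤ t + 2 * N ∧ ∃ j ≤ n,
      Γ'.dist (F j) (g b) ≤ N ∧
      Γ'.dist (F j) (g b) + 2 * N ≤ Γ'.dist (g b) (g t) + Γ'.dist (F j) (g t) := by
    by_cases h2 : t + 2 * N ≤ L
    · obtain ⟨i, hi, hiN⟩ := hN (t + 2 * N) h2
      have := hfar i hi
      have h3 := hg.dist_add t (t + 2 * N) (by omega) h2
      rw [Γ'.dist_comm] at hiN h3
      exact ⟨t + 2 * N, h2, by omega, by omega, i, hi, hiN, by omega⟩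
    · have := hfar n le_rfl
      refine ⟨L, le_rfl, htL, by omega, n, le_rfl, ?_⟩
      rw [hg.finish, ← hy, Γ'.dist_self]
      omega
  obtain ⟨m, e, he0, hem, hstep, heN, hm⟩ : ∃ (m : ℕ) (e : ℕ → W), e 0 = F i ∧ e m = F j ∧
      (∀ s < m, Γ'.dist (e s) (e (s + 1)) ≤ K) ∧ (∀ s ≤ m, N ≤ Γ'.dist (e s) (g t)) ∧
      m ≤ K * Γ'.dist (F i) (F j) := by
    rcases le_total i j with hij | hij
    · refine ⟨j - i, fun s => F (i + s), rfl, by simp [Nat.add_sub_cancel' hij],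
        fun s hs => hK _ (by omega), fun s hs => hfar _ (by omega), ?_⟩
      have := hF i j hij hj
      omega
    · refine ⟨i - j, fun s => F (i - s), rfl, by simp [Nat.sub_sub_self hij],
        fun s hs => ?_, fun s hs => hfar _ (by omega), ?_⟩
      · have := hK (i - (s + 1)) (by omega)
        rwa [show i - (s + 1) + 1 = i - s by omega, Γ'.dist_comm] at this
      · have := hF j i hij hi
        rw [Γ'.dist_comm] at this
        omega
  have hab := hg.dist_add a b (by omega) hbL
  have hat' := hg.dist_add a t hat htL
  have htb' := hg.dist_add t b htb hbL
  rw [Γ'.dist_comm] at htb'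
  have hij : Γ'.dist (F i) (F j) ≤ 6 * N := by
    have h1 := hΓ.dist_triangle (u := F i) (v := g a) (w := F j)
    have h2 := hΓ.dist_triangle (u := g a) (v := g b) (w := F j)
    rw [Γ'.dist_comm (u := F i) (v := g a)] at h1
    rw [Γ'.dist_comm (u := g b) (v := F j)] at h2
    omega
  have hm2 : m + 2 ≤ 2 ^ k := by
    have := Nat.mul_le_mul_left K hij
    refine le_trans ?_ hk
    nlinarith
  let X : ℕ → W := fun s => if s = 0 then g a else if s ≤ m + 1 then e (s - 1) else g b
  have hX0 : X 0 = g a := by simp [X]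
  have hXm : X (0 + (m + 2)) = g b := by simp [X]
  -- The detour `g a`, `F i`, …, `F j`, `g b` avoids `g t`, a point between its ends, where their
  -- Gromov product vanishes. Some step thus has doubled product at most `k * D`, whereas every step
  -- has at least `2 * N - K`.
  obtain ⟨s, -, hs, H⟩ := h.exists_step X (g t) k 0 (m + 2) (by omega) hm2
  rw [hX0, hXm] at H
  rcases Nat.eq_zero_or_pos s with rfl | hs0
  · have h1 : X (0 + 1) = F i := by simp [X, he0]
    rw [hX0, h1] at H
    omega
  rcases Nat.lt_or_ge s (m + 1) with hs1 | hs1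
  · obtain ⟨s, rfl⟩ : ∃ r, s = r + 1 := ⟨s - 1, by omega⟩
    have h1 : X (s + 1) = e s := by simp [X]; omega
    have h2 : X (s + 1 + 1) = e (s + 1) := by simp [X]; omega
    rw [h1, h2] at H
    have h3 := hstep s (by omega)
    have h4 := heN s (by omega)
    have h5 := heN (s + 1) (by omega)
    omega
  · obtain rfl : s = m + 1 := by omega
    have h1 : X (m + 1) = F j := by simp [X, hem]
    have h2 : X (m + 1 + 1) = g b := by simp [X]
    rw [h1, h2] at H
    omega

/-- Each `g t` is near some `F j`. Moving along `g`, the index passes from at most `i` to at least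
`i` between neighbouring points; the two indices then differ by at most `K * (2 * R + 1)`, so `F i`
is near as well. -/
theorem exists_quasigeodesic_near_geodesic (hΓ : Γ'.Connected) {K R : ℕ} {F g : ℕ → W} {n L : ℕ}
    {x y : W} (hx : F 0 = x) (hy : F n = y) (hK : ∀ i < n, Γ'.dist (F i) (F (i + 1)) ≤ K)
    (hF : ∀ i j, i ≤ j → j ≤ n → j ≤ K * Γ'.dist (F i) (F j) + i)
    (hg : IsGeodesicSeq Γ' g L x y) (hR : ∀ t ≤ L, ∃ i ≤ n, Γ'.dist (g t) (F i) ≤ R) :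
    ∀ i ≤ n, ∃ t ≤ L, Γ'.dist (F i) (g t) ≤ R + K * (K * (2 * R + 1)) := by
  intro i hi
  have hup := dist_comp_le_of_adj hΓ hK
  let P : ℕ → Prop := fun t => ∃ j ≤ n, i ≤ j ∧ Γ'.dist (g t) (F j) ≤ R
  have near : ∀ t ≤ L, ∀ j ≤ i, ∀ j' ≤ n, i ≤ j' → Γ'.dist (g t) (F j) ≤ R →
      Γ'.dist (F j) (F j') ≤ 2 * R + 1 →
      ∃ t ≤ L, Γ'.dist (F i) (g t) ≤ R + K * (K * (2 * R + 1)) := by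
    intro t ht j hj j' hj' hij' h1 h2
    refine ⟨t, ht, ?_⟩
    have h3 := hF j j' (by omega) hj'
    have h4 := hup j i hj hi
    have h5 := Nat.mul_le_mul_left K h2
    have h6 : K * (i - j) ≤ K * (K * (2 * R + 1)) := Nat.mul_le_mul_left K (by omega)
    have h7 := hΓ.dist_triangle (u := g t) (v := F j) (w := F i)
    rw [Γ'.dist_comm]
    omega
  by_cases h0 : P 0
  · obtain ⟨j, hj, hij, hd⟩ := h0
    rw [hg.start, ← hx] at hd
    refine near 0 (Nat.zero_le L) 0 (Nat.zero_le i) j hj hij ?_ (by omega)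
    rw [hg.start, hx]
    simp
  · have hPL : P L := ⟨n, le_rfl, hi, by rw [hg.finish, hy]; simp⟩
    obtain ⟨t, htL, htP, htP'⟩ : ∃ t < L, ¬ P t ∧ P (t + 1) := by
      by_contra hcon
      push Not at hcon
      have : ∀ t ≤ L, ¬ P t := by
        intro t
        induction t with
        | zero => exact fun _ => h0
        | succ t ih => exact fun ht => hcon t ht (ih (by omega))
      exact this L le_rfl hPL
    obtain ⟨j, hj, hjd⟩ := hR t htL.le
    obtain ⟨j', hj', hij', hjd'⟩ := htP'
    have hji : j ≤ i := by
      by_contra hlt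
      exact htP ⟨j, hj, by omega, hjd⟩
    have hstep := hg.dist_add t (t + 1) (by omega) htL
    refine near t htL.le j hji j' hj' hij' hjd ?_
    have h1 := hΓ.dist_triangle (u := F j) (v := g t) (w := F j')
    have h2 := hΓ.dist_triangle (u := g t) (v := g (t + 1)) (w := F j')
    rw [Γ'.dist_comm (u := F j) (v := g t)] at h1
    omega

end Morse

/-! ### Hyperbolicity under bi-Lipschitz maps. -/

section BiLipschitz

variable {V W : Type*} {Γ : SimpleGraph V} {Γ' : SimpleGraph W}

/-- The image of a side fellow-travels a geodesic with the same ends. The four-point inequality puts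
a point of that geodesic almost between the ends of one of the other two sides, hence near the image
of that side; the lower Lipschitz bound pulls this back. -/
theorem FourPoint.exists_slimTriangles_of_biLipschitz (hΓ' : Γ'.Connected) {D : ℕ}
    (h : FourPoint Γ' D) (f : V → W) (K : ℕ)
    (hf : ∀ x y, Γ'.dist (f x) (f y) ≤ K * Γ.dist x y)
    (hf' : ∀ x y, Γ.dist x y ≤ K * Γ'.dist (f x) (f y)) : ∃ T, SlimTriangles Γ T := by
  obtain ⟨R, hR⟩ := h.exists_geodesic_near_quasigeodesic hΓ' K
  have hstep : ∀ {c : ℕ → V} {n x y}, IsGeodesicSeq Γ c n x y →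
      ∀ i < n, Γ'.dist (f (c i)) (f (c (i + 1))) ≤ K := by
    intro c n x y hc i hi
    have h1 := hf (c i) (c (i + 1))
    have h2 := hc.dist_add i (i + 1) (by omega) hi
    rw [show Γ.dist (c i) (c (i + 1)) = 1 by omega] at h1
    omega
  have hlow : ∀ {c : ℕ → V} {n x y}, IsGeodesicSeq Γ c n x y →
      ∀ i j, i ≤ j → j ≤ n → j ≤ K * Γ'.dist (f (c i)) (f (c j)) + i := by
    intro c n x y hc i j hij hj
    have h1 := hf' (c i) (c j)
    have h2 := hc.dist_add i j hij hj
    omega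
  have hR' : ∀ {c : ℕ → V} {n x y}, IsGeodesicSeq Γ c n x y → ∀ {g L},
      IsGeodesicSeq Γ' g L (f x) (f y) → ∀ t ≤ L, ∃ i ≤ n, Γ'.dist (g t) (f (c i)) ≤ R := by
    intro c n x y hc g L hg
    exact hR (f ∘ c) g n L (f x) (f y) (by simp [hc.start]) (by simp [hc.finish])
      (hstep hc) (hlow hc) hg
  obtain ⟨R₂, hR₂⟩ : ∃ R₂, R₂ = R + K * (K * (2 * R + 1)) := ⟨_, rfl⟩
  have side : ∀ {a : ℕ → V} {k x z}, IsGeodesicSeq Γ a k x z → ∀ (v : V) (w : W),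
      Γ'.dist (f v) w ≤ R₂ →
      Γ'.dist (f x) w + Γ'.dist (f z) w ≤ Γ'.dist (f x) (f z) + D →
      ∃ j ≤ k, Γ.dist v (a j) ≤ K * (R₂ + (2 * D + 1) + R) := by
    intro a k x z ha v w hvw hw
    obtain ⟨g, L, hg⟩ := exists_isGeodesicSeq hΓ' (f x) (f z)
    obtain ⟨t, ht, hwt⟩ := h.exists_dist_geodesic_le hΓ' hg w
    obtain ⟨j, hj, hjt⟩ := hR' ha hg t ht
    refine ⟨j, hj, (hf' _ _).trans (Nat.mul_le_mul_left K ?_)⟩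
    have h1 := hΓ'.dist_triangle (u := f v) (v := w) (w := f (a j))
    have h2 := hΓ'.dist_triangle (u := w) (v := g t) (w := f (a j))
    omega
  refine ⟨K * (R₂ + (2 * D + 1) + R), fun x y z c a b n k l hc ha hb i hi => ?_⟩
  obtain ⟨g, L, hg⟩ := exists_isGeodesicSeq hΓ' (f x) (f y)
  obtain ⟨t, ht, hit⟩ := exists_quasigeodesic_near_geodesic hΓ' (F := f ∘ c) (by simp [hc.start])
    (by simp [hc.finish]) (hstep hc) (hlow hc) hg (hR' hc hg) i hi
  rw [← hR₂] at hit
  have h1 := hg.dist_start ht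
  have h2 := hg.dist_finish ht
  rw [Γ'.dist_comm] at h2
  have h3 := hg.length_eq
  rcases h (f x) (f y) (f z) (g t) with h' | h'
  · exact Or.inl (side ha _ _ hit (by omega))
  · rw [Γ'.dist_comm (u := f y)] at h'
    exact Or.inr (side hb _ _ hit (by omega))

theorem SlimTriangles.fourPoint (hΓ : Γ.Connected) {T : ℕ} (h : SlimTriangles Γ T) :
    FourPoint Γ (6 * T + 2) := by
  have tri : ∀ u v w : V, Γ.dist u w ≤ Γ.dist u v + Γ.dist v w := fun u v w => hΓ.dist_triangle
  have through : ∀ {a : ℕ → V} {k x z}, IsGeodesicSeq Γ a k x z → ∀ j ≤ k, ∀ (v : V),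
      Γ.dist x v + Γ.dist v z ≤ Γ.dist x z + 2 * Γ.dist v (a j) := by
    intro a k x z ha j hj v
    have h1 := ha.dist_start hj
    have h2 := ha.dist_finish hj
    have h3 := ha.length_eq
    have h4 := tri x (a j) v
    have h5 := tri v (a j) z
    rw [Γ.dist_comm (u := a j) (v := v)] at h4
    omega
  -- Some point of `[x, y]` is close to both `[x, o]` and `[o, y]`: the last one before leaving the
  -- `T`-neighbourhood of `[x, o]`, whence `T + 1`.
  have mid : ∀ {c : ℕ → V} {n x y}, IsGeodesicSeq Γ c n x y → ∀ o, ∃ i ≤ n,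
      2 * Γ.dist o (c i) + Γ.dist x y ≤ Γ.dist x o + Γ.dist y o + 4 * T + 2 := by
    intro c n x y hc o
    obtain ⟨a, k, ha⟩ := exists_isGeodesicSeq hΓ x o
    obtain ⟨b, l, hb⟩ := exists_isGeodesicSeq hΓ o y
    have hslim := h x y o c a b n k l hc ha hb
    let P : ℕ → Prop := fun i => ∃ j ≤ k, Γ.dist (c i) (a j) ≤ T
    have hP0 : P 0 := ⟨0, Nat.zero_le k, by rw [hc.start, ha.start]; simp⟩
    obtain ⟨i, hi, ⟨j, hj, hjT⟩, j', hj', hjT'⟩ :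
        ∃ i ≤ n, P i ∧ ∃ j ≤ l, Γ.dist (c i) (b j) ≤ T + 1 := by
      by_cases hPn : P n
      · exact ⟨n, le_rfl, hPn, l, le_rfl, by rw [hc.finish, hb.finish]; simp⟩
      obtain ⟨i, hin, hPi, hPi'⟩ : ∃ i < n, P i ∧ ¬ P (i + 1) := by
        by_contra hcon
        push Not at hcon
        have : ∀ i ≤ n, P i := by
          intro i
          induction i with
          | zero => exact fun _ => hP0
          | succ i ih => exact fun hi => hcon i hi (ih (by omega))
        exact hPn (this n le_rfl)
      obtain ⟨j, hj, hjT⟩ := (hslim (i + 1) hin).resolve_left hPi'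
      refine ⟨i, hin.le, hPi, j, hj, ?_⟩
      have h1 := hc.dist_add i (i + 1) (by omega) hin
      have h2 := tri (c i) (c (i + 1)) (b j)
      omega
    refine ⟨i, hi, ?_⟩
    have h1 := through ha j hj (c i)
    have h2 := through hb j' hj' (c i)
    have h3 := hc.dist_start hi
    have h4 := hc.dist_finish hi
    have h5 := hc.length_eq
    rw [Γ.dist_comm (u := c i) (v := o)] at h1
    rw [Γ.dist_comm (u := o) (v := y)] at h2
    omega
  intro x y z o
  obtain ⟨c, n, hc⟩ := exists_isGeodesicSeq hΓ x y
  obtain ⟨a, k, ha⟩ := exists_isGeodesicSeq hΓ x z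
  obtain ⟨b, l, hb⟩ := exists_isGeodesicSeq hΓ z y
  obtain ⟨i, hi, hio⟩ := mid hc o
  have far : ∀ {a : ℕ → V} {k x z}, IsGeodesicSeq Γ a k x z → ∀ j ≤ k, Γ.dist (c i) (a j) ≤ T →
      Γ.dist x o + Γ.dist z o ≤ Γ.dist x z + 2 * Γ.dist o (c i) + 2 * T := by
    intro a k x z ha j hj hjT
    have h1 := through ha j hj o
    have h2 := tri o (c i) (a j)
    rw [Γ.dist_comm (u := o) (v := z)] at h1
    omega
  -- The same point of `[x, y]` is `T`-close to `[x, z]` or `[z, y]`; the two errors `4 * T + 2` and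
  -- `2 * T` add up.
  rcases h x y z c a b n k l hc ha hb i hi with ⟨j, hj, hjT⟩ | ⟨j, hj, hjT⟩
  · have := far ha j hj hjT
    left
    omega
  · have := far hb j hj hjT
    rw [Γ.dist_comm (u := z) (v := y)] at this
    right
    omega

/-- Hyperbolicity passes to connected graphs admitting a bi-Lipschitz map to a hyperbolic one. -/
theorem IsHyperbolicGraph.of_biLipschitz (hΓ : Γ.Connected) (h : IsHyperbolicGraph Γ')
    (f : V → W) (K : ℕ) (hf : ∀ x y, Γ'.dist (f x) (f y) ≤ K * Γ.dist x y)
    (hf' : ∀ x y, Γ.dist x y ≤ K * Γ'.dist (f x) (f y)) : IsHyperbolicGraph Γ := by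
  obtain ⟨D, hD⟩ := h.exists_fourPoint
  obtain ⟨T, hT⟩ := hD.exists_slimTriangles_of_biLipschitz h.1 f K hf hf'
  exact (hT.fourPoint hΓ).isHyperbolicGraph hΓ

end BiLipschitz

/-! ### Half-trees in the amalgam. -/

namespace Monoid.PushoutI

open CoprodI

variable {ι : Type*} {G : ι → Type*} {U : Type*} [∀ i, Group (G i)] [Group U] {φ : ∀ i, U →* G i}

/-- The elements of the amalgam with a reduced expression whose first letter lies outside the
factor `G i₀` and whose last letter lies in the factor `G j`. -/
inductive HalfTree (φ : ∀ i, U →* G i) (i₀ : ι) : ι → PushoutI φ → Prop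
  | of {j : ι} (hj : j ≠ i₀) (y : G j) (hy : y ∉ (φ j).range) : HalfTree φ i₀ j (of j y)
  | mul {j k : ι} {h : PushoutI φ} (hh : HalfTree φ i₀ j h) (hjk : j ≠ k) (y : G k)
      (hy : y ∉ (φ k).range) : HalfTree φ i₀ k (h * PushoutI.of k y)

theorem HalfTree.mul_base {i₀ j : ι} {h : PushoutI φ} (hh : HalfTree φ i₀ j h) (u : U) :
    HalfTree φ i₀ j (h * base φ u) := by
  have key : ∀ {k : ι} {y : G k}, y ∉ (φ k).range → y * φ k u ∉ (φ k).range := fun hy hyu =>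
    hy ((Subgroup.mul_mem_cancel_right _ (MonoidHom.mem_range.2 ⟨u, rfl⟩)).1 hyu)
  cases hh with
  | of hj y hy =>
    rw [← of_apply_eq_base φ j, ← map_mul]
    exact .of hj _ (key hy)
  | mul hh hjk y hy =>
    rw [← of_apply_eq_base φ j, mul_assoc, ← map_mul]
    exact .mul hh hjk _ (key hy)

/-- Multiplying by an element of a factor, one leaves a half-tree only through `U`. -/
theorem HalfTree.mul_of {i₀ j : ι} {h : PushoutI φ} (hh : HalfTree φ i₀ j h) (k : ι) (x : G k) :
    (∃ l, HalfTree φ i₀ l (h * PushoutI.of k x)) ∨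
      h * PushoutI.of k x ∈ (base φ).range := by
  by_cases hjk : j = k
  · subst hjk
    cases hh with
    | of hj y hy =>
      rw [← map_mul]
      by_cases hyx : y * x ∈ (φ j).range
      · obtain ⟨u, hu⟩ := hyx
        exact Or.inr ⟨u, by rw [← hu, of_apply_eq_base]⟩
      · exact Or.inl ⟨j, .of hj _ hyx⟩
    | mul hh hjk y hy =>
      rw [mul_assoc, ← map_mul]
      by_cases hyx : y * x ∈ (φ j).range
      · obtain ⟨u, hu⟩ := hyx
        rw [← hu, of_apply_eq_base]
        exact Or.inl ⟨_, hh.mul_base u⟩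
      · exact Or.inl ⟨j, .mul hh hjk _ hyx⟩
  · left
    by_cases hx : x ∈ (φ k).range
    · obtain ⟨u, rfl⟩ := hx
      rw [of_apply_eq_base]
      exact ⟨_, hh.mul_base u⟩
    · exact ⟨_, .mul hh hjk _ hx⟩

theorem HalfTree.exists_neWord {i₀ j : ι} {h : PushoutI φ} (hh : HalfTree φ i₀ j h) :
    ∃ i, i ≠ i₀ ∧ ∃ w : NeWord G i j, Reduced φ w.toWord ∧ ofCoprodI w.prod = h := by
  have one {k : ι} {y : G k} (hy : y ∉ (φ k).range) : y ≠ 1 := fun h1 => hy (h1 ▸ one_mem _)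
  induction hh with
  | @of j hj y hy =>
    refine ⟨j, hj, .singleton y (one hy), ?_, by simp⟩
    intro g hg
    simp only [NeWord.toWord, NeWord.toList, List.mem_singleton] at hg
    subst hg
    exact hy
  | @mul j k h hh hjk y hy ih =>
    obtain ⟨i, hi, w, hw, rfl⟩ := ih
    refine ⟨i, hi, .append w hjk (.singleton y (one hy)), ?_, by simp⟩
    intro g hg
    simp only [NeWord.toWord, NeWord.toList, List.mem_append, List.mem_singleton] at hg
    rcases hg with hg | rfl
    · exact hw g hg
    · exact hy

/-- If `h` were some `g` in the factor, then `h` would be a nonempty reduced word with value in `U`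
when `g` is in `U`; otherwise prefixing `g⁻¹` would give a nonempty reduced word with value `1`. The
normal form theorem excludes both. -/
theorem HalfTree.notMem_range_of (hφ : ∀ i, Function.Injective (φ i)) {i₀ j : ι}
    {h : PushoutI φ} (hh : HalfTree φ i₀ j h) : h ∉ (PushoutI.of (φ := φ) i₀).range := by
  obtain ⟨i, hi, w, hw, rfl⟩ := hh.exists_neWord
  have key : ∀ {i j : ι} (w : NeWord G i j), Reduced φ w.toWord →
      ofCoprodI w.prod ∉ (base φ).range := by
    intro i j w hw hmem
    have := Reduced.eq_empty_of_mem_range hφ hw hmem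
    exact w.toList_ne_nil (congrArg Word.toList this)
  rintro ⟨g, hg⟩
  by_cases hgU : g ∈ (φ i₀).range
  · obtain ⟨u, rfl⟩ := hgU
    exact key w hw ⟨u, by rw [← hg, of_apply_eq_base]⟩
  · have hg' : g⁻¹ ∉ (φ i₀).range := by rwa [inv_mem_iff]
    have hg1 : g⁻¹ ≠ 1 := fun h1 => hg' (h1 ▸ one_mem _)
    refine key (.append (.singleton g⁻¹ hg1) hi.symm w) ?_ ⟨1, ?_⟩
    · intro g' hmem
      simp only [NeWord.toWord, NeWord.toList, List.mem_append, List.mem_singleton] at hmem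
      rcases hmem with rfl | hmem
      · exact hg'
      · exact hw g' hmem
    · simp [← hg]

/-- The half-trees hanging off the vertex `G i₀` cover the complement of `G i₀`. -/
theorem mem_range_of_or_halfTree (i₀ : ι) (h : PushoutI φ) :
    h ∈ (of (φ := φ) i₀).range ∨ ∃ (g : G i₀) (j : ι), HalfTree φ i₀ j ((of i₀ g)⁻¹ * h) := by
  let P : PushoutI φ → Prop := fun h =>
    h ∈ (of (φ := φ) i₀).range ∨ ∃ (g : G i₀) (j : ι), HalfTree φ i₀ j ((of i₀ g)⁻¹ * h)
  have hof : ∀ (k : ι) (x : G k) (h : PushoutI φ), P h → P (h * of k x) := by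
    intro k x h hP
    by_cases hx : x ∈ (φ k).range
    · obtain ⟨u, rfl⟩ := hx
      rcases hP with hP | ⟨g, j, hj⟩
      · refine Or.inl (mul_mem hP ⟨φ i₀ u, ?_⟩)
        rw [of_apply_eq_base, of_apply_eq_base]
      · refine Or.inr ⟨g, j, ?_⟩
        rw [of_apply_eq_base, ← mul_assoc]
        exact hj.mul_base u
    rcases hP with ⟨g, rfl⟩ | ⟨g, j, hj⟩
    · by_cases hk : k = i₀
      · subst hk
        exact Or.inl ⟨g * x, map_mul _ _ _⟩
      · refine Or.inr ⟨g, k, ?_⟩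
        rw [inv_mul_cancel_left]
        exact .of hk x hx
    · rcases hj.mul_of k x with ⟨l, hl⟩ | ⟨u, hu⟩
      · exact Or.inr ⟨g, l, by rwa [← mul_assoc]⟩
      · refine Or.inl ⟨g * φ i₀ u, ?_⟩
        rw [map_mul, of_apply_eq_base, hu]
        group
  -- Generalizing over the left factor lets the induction run through right multiplications only.
  have hmul : ∀ h h' : PushoutI φ, P h' → P (h' * h) := by
    intro h
    induction h using PushoutI.induction_on with
    | of i g => exact fun h' => hof i g h'
    | base u =>
      intro h' hP
      rw [← of_apply_eq_base φ i₀]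
      exact hof _ _ _ hP
    | mul x y hx hy =>
      intro h' hP
      rw [← mul_assoc]
      exact hy _ (hx _ hP)
  have := hmul h 1 (Or.inl (one_mem _))
  rwa [one_mul] at this

/-- Every element `s` has finitely many prefixes such that any right multiplication by `s`
leaving a half-tree passes through `U` at one of them. -/
theorem exists_finite_prefixes (i₀ : ι) (s : PushoutI φ) : ∃ P : Set (PushoutI φ), P.Finite ∧
    ∀ h : PushoutI φ, (∃ j, HalfTree φ i₀ j h) → (¬ ∃ j, HalfTree φ i₀ j (h * s)) →
      ∃ q ∈ P, h * q ∈ (base φ).range := by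
  induction s using PushoutI.induction_on with
  | of i g =>
    refine ⟨{of i g}, Set.finite_singleton _, ?_⟩
    rintro h ⟨j, hj⟩ hn
    exact ⟨_, rfl, (hj.mul_of i g).resolve_left hn⟩
  | base u =>
    refine ⟨∅, Set.finite_empty, ?_⟩
    rintro h ⟨j, hj⟩ hn
    exact (hn ⟨j, hj.mul_base u⟩).elim
  | mul x y hx hy =>
    obtain ⟨P, hPf, hP⟩ := hx
    obtain ⟨Q, hQf, hQ⟩ := hy
    -- The exit happens either while multiplying by `x`, or afterwards while multiplying by `y`.
    refine ⟨P ∪ (x * ·) '' Q, hPf.union (hQf.image _), fun h hh hn => ?_⟩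
    by_cases hx : ∃ j, HalfTree φ i₀ j (h * x)
    · obtain ⟨q, hq, hmem⟩ := hQ (h * x) hx (by rwa [mul_assoc])
      exact ⟨x * q, Or.inr ⟨q, hq, rfl⟩, by rwa [← mul_assoc]⟩
    · obtain ⟨q, hq, hmem⟩ := hP h hh hx
      exact ⟨q, Or.inl hq, hmem⟩

end Monoid.PushoutI

/-! ### Cayley graphs and quasiconvex subgroups. -/

section Cayley

variable {V W : Type*} {Γ : SimpleGraph V} {Γ' : SimpleGraph W}

theorem dist_map_le_of_adj (hΓ : Γ.Connected) (hΓ' : Γ'.Connected) {f : V → W} {K : ℕ}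
    (h : ∀ x y, Γ.Adj x y → Γ'.dist (f x) (f y) ≤ K) (x y : V) :
    Γ'.dist (f x) (f y) ≤ K * Γ.dist x y := by
  obtain ⟨p, hp⟩ := hΓ.exists_walk_length_eq_dist x y
  have := dist_comp_le_of_adj hΓ' (c := fun i => f (p.getVert i)) (n := p.length)
    (fun i hi => h _ _ (p.adj_getVert_succ hi)) 0 p.length (Nat.zero_le _) le_rfl
  rwa [Nat.sub_zero, p.getVert_zero, p.getVert_length, hp] at this

variable {H : Type*} [Group H] {S : Set H}

theorem mulCayley_connected (hS : Subgroup.closure S = ⊤) :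
    (SimpleGraph.mulCayley S).Connected := by
  have key : ∀ h : H, ∀ g, (SimpleGraph.mulCayley S).Reachable g (g * h) := by
    intro h
    have hh : h ∈ Subgroup.closure S := hS ▸ Subgroup.mem_top h
    induction hh using Subgroup.closure_induction with
    | mem s hs =>
      intro g
      by_cases hg : g = g * s
      · rw [← hg]
      · exact ((SimpleGraph.mulCayley_adj' S _ _).2 ⟨hg, s, hs, Or.inl rfl⟩).reachable
    | one => intro g; rw [mul_one]
    | mul x y _ _ hx hy => intro g; rw [← mul_assoc]; exact (hx g).trans (hy _)
    | inv x _ hx => intro g; simpa using (hx (g * x⁻¹)).symm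
  refine SimpleGraph.connected_iff _ |>.2 ⟨fun x y => ?_, ⟨1⟩⟩
  simpa using key (x⁻¹ * y) x

theorem dist_mul_left_mulCayley (hS : (SimpleGraph.mulCayley S).Connected) (g x y : H) :
    (SimpleGraph.mulCayley S).dist (g * x) (g * y) = (SimpleGraph.mulCayley S).dist x y := by
  have key : ∀ g x y : H,
      (SimpleGraph.mulCayley S).dist (g * x) (g * y) ≤ (SimpleGraph.mulCayley S).dist x y := by
    intro g x y
    have := dist_map_le_of_adj hS hS (f := (g * ·)) (K := 1) (fun x y hxy =>
      (SimpleGraph.dist_eq_one_iff_adj.2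
        ((SimpleGraph.mulCayley_adj_mul_iff_right (d := g)).2 hxy)).le) x y
    simpa using this
  refine le_antisymm (key g x y) ?_
  simpa using key g⁻¹ (g * x) (g * y)

theorem dist_mulCayley_eq_dist_one (hS : (SimpleGraph.mulCayley S).Connected) (x y : H) :
    (SimpleGraph.mulCayley S).dist x y = (SimpleGraph.mulCayley S).dist 1 (x⁻¹ * y) := by
  simpa using (dist_mul_left_mulCayley hS x⁻¹ x y).symm

/-- A homomorphism mapping the generators into a ball is Lipschitz. -/
theorem dist_map_le_mulCayley {H' : Type*} [Group H'] {S' : Set H'}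
    (hS : (SimpleGraph.mulCayley S).Connected) (hS' : (SimpleGraph.mulCayley S').Connected)
    (f : H →* H') {K : ℕ} (hK : ∀ s ∈ S, (SimpleGraph.mulCayley S').dist 1 (f s) ≤ K) (x y : H) :
    (SimpleGraph.mulCayley S').dist (f x) (f y) ≤ K * (SimpleGraph.mulCayley S).dist x y := by
  refine dist_map_le_of_adj hS hS' (fun x y hxy => ?_) x y
  rcases ((SimpleGraph.mulCayley_adj S x y).1 hxy).2 with h | h
  · rw [dist_mulCayley_eq_dist_one hS', ← map_inv, ← map_mul]
    exact hK _ h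
  · rw [SimpleGraph.dist_comm, dist_mulCayley_eq_dist_one hS', ← map_inv, ← map_mul]
    exact hK _ h

theorem Set.Finite.exists_nat_bound {α : Type*} {P : Set α} (hP : P.Finite) (f : α → ℕ) :
    ∃ K, ∀ s ∈ P, f s ≤ K := by
  obtain ⟨K, hK⟩ := (hP.image f).bddAbove
  exact ⟨K, fun s hs => hK (Set.mem_image_of_mem f hs)⟩

theorem finite_ball_mulCayley (hfin : S.Finite) (hS : (SimpleGraph.mulCayley S).Connected)
    (n : ℕ) : {h : H | (SimpleGraph.mulCayley S).dist 1 h ≤ n}.Finite := by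
  induction n with
  | zero =>
    refine (Set.finite_singleton 1).subset fun h hh => ?_
    exact (hS.dist_eq_zero_iff.1 (Nat.le_zero.1 hh)).symm
  | succ n ih =>
    refine (ih.union ((ih.mul hfin).union (ih.mul hfin.inv))).subset fun h hh => ?_
    rcases Nat.lt_or_ge n ((SimpleGraph.mulCayley S).dist 1 h) with hlt | hle
    · obtain ⟨c, m, hc⟩ := exists_isGeodesicSeq hS 1 h
      have hm := hc.length_eq
      have hh' : (SimpleGraph.mulCayley S).dist 1 h ≤ n + 1 := hh
      have h1 := hc.dist_start (i := n) (by omega)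
      have h2 := hc.dist_finish (i := n) (by omega)
      have hadj : (SimpleGraph.mulCayley S).Adj (c n) h :=
        SimpleGraph.dist_eq_one_iff_adj.1 (by omega)
      right
      rcases ((SimpleGraph.mulCayley_adj S _ _).1 hadj).2 with hs | hs
      · exact Or.inl ⟨c n, h1.le, _, hs, by simp⟩
      · exact Or.inr ⟨c n, h1.le, _, Set.inv_mem_inv.2 hs, by simp⟩
    · exact Or.inl hle

/-- The identity is bi-Lipschitz between two finite generating sets, as each has bounded word length
in the other. -/
theorem IsHyperbolicGroup.isHyperbolicGraph (h : IsHyperbolicGroup H) (hfin : S.Finite)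
    (hS : Subgroup.closure S = ⊤) : IsHyperbolicGraph (SimpleGraph.mulCayley S) := by
  obtain ⟨S₀, hfin₀, -, h₀⟩ := h
  have hconn := mulCayley_connected hS
  obtain ⟨K, hK⟩ := hfin.exists_nat_bound ((SimpleGraph.mulCayley S₀).dist 1)
  obtain ⟨K', hK'⟩ := hfin₀.exists_nat_bound ((SimpleGraph.mulCayley S).dist 1)
  refine IsHyperbolicGraph.of_biLipschitz hconn h₀ id (K + K') (fun x y => ?_) fun x y => ?_
  · exact dist_map_le_mulCayley hconn h₀.1 (MonoidHom.id H)
      (fun s hs => (hK s hs).trans (Nat.le_add_right _ _)) x y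
  · exact dist_map_le_mulCayley h₀.1 hconn (MonoidHom.id H)
      (fun s hs => (hK' s hs).trans (Nat.le_add_left _ _)) x y

/-- A quasiconvex embedded subgroup of a group with hyperbolic Cayley graph is hyperbolic. -/
theorem isHyperbolicGroup_of_isQuasiconvexSubgroup {K : Type*} [Group K] (hfin : S.Finite)
    (hS : IsHyperbolicGraph (SimpleGraph.mulCayley S)) (f : K →* H)
    (hf : Function.Injective f) (hq : IsQuasiconvexSubgroup S f.range) :
    IsHyperbolicGroup K := by
  have hconn := hS.1
  obtain ⟨ε, -, hε⟩ := hq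
  obtain ⟨E, hE⟩ := exists_nat_ge ε
  -- Replacing neighbouring vertices of a geodesic by points of the subgroup at distance at most `E`
  -- gives steps of length at most `E + 1 + E`.
  let B : Set K := {g | (SimpleGraph.mulCayley S).dist 1 (f g) ≤ 2 * E + 1}
  have hBfin : B.Finite := (finite_ball_mulCayley hfin hconn (2 * E + 1)).preimage hf.injOn
  have hpath : ∀ g : K, ∃ a : ℕ → K, a 0 = 1 ∧ a ((SimpleGraph.mulCayley S).dist 1 (f g)) = g ∧
      ∀ i < (SimpleGraph.mulCayley S).dist 1 (f g), (a i)⁻¹ * a (i + 1) ∈ B := by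
    intro g
    obtain ⟨p, hp⟩ := hconn.exists_walk_length_eq_dist 1 (f g)
    -- At the two ends the subgroup element is prescribed, so that the resulting path in `K` runs
    -- exactly from `1` to `g`.
    have hnear : ∀ i, ∃ a : K, (SimpleGraph.mulCayley S).dist (p.getVert i) (f a) ≤ E ∧
        (i = 0 → a = 1) ∧ (i = p.length → a = g) := by
      intro i
      by_cases h0 : i = 0
      · subst h0
        refine ⟨1, by simp, fun _ => rfl, fun h => hf ?_⟩
        rw [map_one, SimpleGraph.Walk.eq_of_length_eq_zero h.symm]
      by_cases hl : i = p.length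
      · subst hl
        exact ⟨g, by simp, fun h => absurd h h0, fun _ => rfl⟩
      · obtain ⟨_, ⟨a, rfl⟩, ha⟩ := hε 1 (one_mem _) (f g) ⟨g, rfl⟩ p hp _ (p.getVert_mem_support i)
        exact ⟨a, by exact_mod_cast ha.trans hE, fun h => absurd h h0, fun h => absurd h hl⟩
    choose a ha ha0 hal using hnear
    refine ⟨a, ha0 0 rfl, hal _ hp.symm, fun i hi => ?_⟩
    rw [← hp] at hi
    change (SimpleGraph.mulCayley S).dist 1 (f ((a i)⁻¹ * a (i + 1))) ≤ 2 * E + 1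
    rw [map_mul, map_inv, ← dist_mulCayley_eq_dist_one hconn]
    have h1 := ha i
    have h2 := ha (i + 1)
    have h3 := SimpleGraph.dist_eq_one_iff_adj.2 (p.adj_getVert_succ hi)
    have h4 := hconn.dist_triangle (u := f (a i)) (v := p.getVert i) (w := f (a (i + 1)))
    have h5 := hconn.dist_triangle (u := p.getVert i) (v := p.getVert (i + 1))
      (w := f (a (i + 1)))
    rw [SimpleGraph.dist_comm (u := f (a i)) (v := p.getVert i)] at h4
    omega
  have hgen : Subgroup.closure B = ⊤ := by
    refine eq_top_iff.2 fun g _ => ?_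
    obtain ⟨a, ha0, hag, ha⟩ := hpath g
    have : ∀ i ≤ (SimpleGraph.mulCayley S).dist 1 (f g), a i ∈ Subgroup.closure B := by
      intro i
      induction i with
      | zero => intro _; rw [ha0]; exact one_mem _
      | succ i ih =>
        intro hi
        have := mul_mem (ih (by omega)) (Subgroup.subset_closure (ha i hi))
        rwa [mul_inv_cancel_left] at this
    exact hag ▸ this _ le_rfl
  have hconn' := mulCayley_connected hgen
  have hone : ∀ b ∈ B, (SimpleGraph.mulCayley B).dist 1 b ≤ 1 := by
    intro b hb
    by_cases h1 : (1 : K) = b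
    · simp [← h1]
    · exact (SimpleGraph.dist_eq_one_iff_adj.2
        ((SimpleGraph.mulCayley_adj B 1 b).2 ⟨h1, Or.inl (by simpa using hb)⟩)).le
  refine ⟨B, hBfin, hgen, hS.of_biLipschitz hconn' f (2 * E + 1) (fun x y => ?_) fun x y => ?_⟩
  · exact dist_map_le_mulCayley hconn' hconn f (fun b hb => hb) x y
  · rw [dist_mulCayley_eq_dist_one hconn', dist_mulCayley_eq_dist_one hconn, ← map_inv, ← map_mul]
    obtain ⟨a, ha0, hag, ha⟩ := hpath (x⁻¹ * y)
    have := dist_comp_le_of_adj hconn' (c := a) (K := 1)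
      (n := (SimpleGraph.mulCayley S).dist 1 (f (x⁻¹ * y))) (fun i hi => by
        rw [dist_mulCayley_eq_dist_one hconn']
        exact hone _ (ha i hi)) 0 _ (Nat.zero_le _) le_rfl
    rw [ha0, hag] at this
    refine this.trans ?_
    rw [Nat.sub_zero]
    gcongr
    omega

end Cayley

/-! ### Quasiconvexity of the factors. -/

section Amalgam

/-- A point on a geodesic whose ends are close to a quasiconvex set is close to that set. -/
theorem FourPoint.exists_dist_le_of_isQuasiconvexIn {V : Type*} {Γ : SimpleGraph V}
    (hΓ : Γ.Connected) {D : ℕ} (h : FourPoint Γ D) {Y : Set V} (hY : IsQuasiconvexIn Γ Y)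
    (C : ℕ) : ∃ R : ℕ, ∀ (c : ℕ → V) (n : ℕ) (x y : V), IsGeodesicSeq Γ c n x y →
      (∃ u ∈ Y, Γ.dist x u ≤ C) → (∃ u ∈ Y, Γ.dist y u ≤ C) → ∀ i ≤ n,
      ∃ u ∈ Y, Γ.dist (c i) u ≤ R := by
  obtain ⟨ε, -, hε⟩ := hY
  obtain ⟨E, hE⟩ := exists_nat_ge ε
  refine ⟨E + C + 2 * D + 1, ?_⟩
  rintro c n x y hc ⟨u, hu, hxu⟩ ⟨v, hv, hyv⟩ i hi
  obtain ⟨p, hp⟩ := hΓ.exists_walk_length_eq_dist u v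
  have hg := p.isGeodesicSeq hΓ hp
  obtain ⟨t, ht, hwt⟩ := h.exists_dist_geodesic_le hΓ hg (c i)
  have h1 := hc.dist_start hi
  have h2 := hc.dist_finish hi
  have h3 := hc.length_eq
  rw [Γ.dist_comm] at h2
  -- Unless `c i` is already near `u` or `v`, the two inequalities combine to place it within Gromov
  -- product `D` of the geodesic `[u, v]`, which is near `Y`.
  rcases h x y u (c i) with h' | h'
  · refine ⟨u, hu, ?_⟩
    rw [Γ.dist_comm (u := u) (v := c i)] at h'
    omega
  rcases h u y v (c i) with h'' | h''
  · obtain ⟨z, hz, hzt⟩ := hε u hu v hv p hp _ (p.getVert_mem_support t)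
    replace hzt : Γ.dist (p.getVert t) z ≤ E := by exact_mod_cast hzt.trans hE
    have h4 := hΓ.dist_triangle (u := c i) (v := p.getVert t) (w := z)
    refine ⟨z, hz, ?_⟩
    rw [Γ.dist_comm (u := u) (v := y)] at h''
    omega
  · refine ⟨v, hv, ?_⟩
    rw [Γ.dist_comm (u := u) (v := y), Γ.dist_comm (u := v) (v := c i)] at h''
    omega

open Monoid Monoid.PushoutI in
/-- The factors of an amalgam with hyperbolic Cayley graph are quasiconvex if the amalgamated
subgroup is. -/
theorem isQuasiconvexSubgroup_range_of {ι : Type*} {G : ι → Type*} {U : Type*}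
    [∀ i, Group (G i)] [Group U] {φ : ∀ i, U →* G i} (hφ : ∀ i, Function.Injective (φ i))
    {S : Set (PushoutI φ)} (hSfin : S.Finite)
    (hS : IsHyperbolicGraph (SimpleGraph.mulCayley S))
    (hU : IsQuasiconvexSubgroup S (base φ).range) (i : ι) :
    IsQuasiconvexSubgroup S (of (φ := φ) i).range := by
  have hconn := hS.1
  obtain ⟨D, hD⟩ := hS.exists_fourPoint
  obtain ⟨C, hC⟩ : ∃ C, ∀ h h' : PushoutI φ, (SimpleGraph.mulCayley S).Adj h h' →
      (∃ j, HalfTree φ i j h) → (¬ ∃ j, HalfTree φ i j h') →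
      ∃ u ∈ (base φ).range, (SimpleGraph.mulCayley S).dist h u ≤ C := by
    -- `C` bounds the lengths of the prefixes of all generators and their inverses.
    choose P hPfin hP using exists_finite_prefixes (φ := φ) i
    obtain ⟨C, hC⟩ := ((hSfin.union hSfin.inv).biUnion fun s _ => hPfin s).exists_nat_bound
      ((SimpleGraph.mulCayley S).dist 1)
    refine ⟨C, fun h h' hadj hh hh' => ?_⟩
    obtain ⟨q, hq, hmem⟩ := hP (h⁻¹ * h') h hh (by rwa [mul_inv_cancel_left])
    refine ⟨_, hmem, ?_⟩
    rw [dist_mulCayley_eq_dist_one hconn, inv_mul_cancel_left]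
    refine hC q (Set.mem_biUnion ?_ hq)
    rcases ((SimpleGraph.mulCayley_adj S h h').1 hadj).2 with hs | hs
    · exact Or.inl hs
    · exact Or.inr (by simpa using hs)
  obtain ⟨R, hR⟩ := hD.exists_dist_le_of_isQuasiconvexIn hconn hU C
  refine ⟨R, by positivity, ?_⟩
  intro x hx y hy p hp w hw
  obtain ⟨k, rfl, hk⟩ := SimpleGraph.Walk.mem_support_iff_exists_getVert.1 hw
  rcases mem_range_of_or_halfTree i (p.getVert k) with hmem | ⟨g, hg⟩
  · exact ⟨_, hmem, by simp⟩
  -- Translating by an element of the factor moves the vertex in question into the half-tree itself,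
  -- while the ends stay in the factor and so outside it.
  let c : ℕ → PushoutI φ := fun s => (of i g)⁻¹ * p.getVert s
  have hc : IsGeodesicSeq (SimpleGraph.mulCayley S) c p.length ((of i g)⁻¹ * x)
      ((of i g)⁻¹ * y) := by
    have := p.isGeodesicSeq hconn hp
    exact ⟨by simp [c], by simp [c], fun a b hab hb => by
      rw [dist_mul_left_mulCayley hconn]
      exact this.dist_add a b hab hb⟩
  have hnot : ∀ z ∈ (of (φ := φ) i).range, ¬ ∃ j, HalfTree φ i j ((of i g)⁻¹ * z) := by
    rintro z hz ⟨j, hj⟩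
    exact hj.notMem_range_of hφ (mul_mem (inv_mem ⟨g, rfl⟩) hz)
  have hadj : ∀ s < p.length, (SimpleGraph.mulCayley S).Adj (c s) (c (s + 1)) := fun s hs =>
    SimpleGraph.mulCayley_adj_mul_iff_right.2 (p.adj_getVert_succ hs)
  -- If no vertex up to `k` were near `U`, no edge could cross the boundary, and the half-tree would
  -- contain the start.
  obtain ⟨a, hak, ha⟩ : ∃ a ≤ k, ∃ u ∈ (base φ).range,
      (SimpleGraph.mulCayley S).dist (c a) u ≤ C := by
    by_contra hcon
    push Not at hcon
    have : ∀ s ≤ k, ∃ j, HalfTree φ i j (c (k - s)) := by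
      intro s
      induction s with
      | zero => exact fun _ => hg
      | succ s ih =>
        intro hs
        by_contra hn
        have h1 := hadj (k - (s + 1)) (by omega)
        rw [show k - (s + 1) + 1 = k - s by omega] at h1
        obtain ⟨u, hu, hd⟩ := hC _ _ h1.symm (ih (by omega)) hn
        exact (hcon (k - s) (by omega) u hu).not_ge hd
    have h0 := this k le_rfl
    rw [Nat.sub_self, hc.start] at h0
    exact hnot x hx h0
  obtain ⟨b, hkb, hbl, hb⟩ : ∃ b, k ≤ b ∧ b ≤ p.length ∧ ∃ u ∈ (base φ).range,
      (SimpleGraph.mulCayley S).dist (c b) u ≤ C := by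
    by_contra hcon
    push Not at hcon
    have : ∀ s, k + s ≤ p.length → ∃ j, HalfTree φ i j (c (k + s)) := by
      intro s
      induction s with
      | zero => exact fun _ => hg
      | succ s ih =>
        intro hs
        by_contra hn
        obtain ⟨u, hu, hd⟩ := hC _ _ (hadj (k + s) (by omega)) (ih (by omega)) hn
        exact (hcon (k + s) (by omega) (by omega) u hu).not_ge hd
    have h0 := this (p.length - k) (by omega)
    rw [Nat.add_sub_cancel' hk, hc.finish] at h0
    exact hnot y hy h0
  obtain ⟨u, ⟨u', rfl⟩, hd⟩ := hR _ _ _ _ (hc.subpath (hak.trans hkb) hbl) ha hb (k - a) (by omega)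
  -- Translating back turns a point of `U` into a point of `g U`, which lies in the factor.
  refine ⟨of i g * base φ u', ⟨g * φ i u', by rw [map_mul, of_apply_eq_base]⟩, ?_⟩
  have h1 := dist_mul_left_mulCayley hconn (of i g) (c k) (base φ u')
  rw [mul_inv_cancel_left] at h1
  rw [Nat.add_sub_cancel' hak, ← h1] at hd
  exact_mod_cast hd

end Amalgam

/-- `Monoid.PushoutI φ` is the amalgam `H = G₁ *_U G₂` of the two groups `G 0`, `G 1` along the
injective homomorphisms `φ 0 : U → G 0` and `φ 1 : U → G 1`. -/
theorem theorem6 {G : Fin 2 → Type*} {U : Type*} [∀ i, Group (G i)] [Group U]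
    (φ : ∀ i, U →* G i) (hφ : ∀ i, Function.Injective (φ i))
    (hH : IsHyperbolicGroup (Monoid.PushoutI φ))
    (S : Set (Monoid.PushoutI φ)) (hSfin : S.Finite) (hSgen : Subgroup.closure S = ⊤)
    (hU : IsQuasiconvexSubgroup S (Monoid.PushoutI.base φ).range) :
    (∀ i, IsQuasiconvexSubgroup S (Monoid.PushoutI.of (φ := φ) i).range) ∧
      (∀ i, IsHyperbolicGroup (G i)) := by
  have hS := hH.isHyperbolicGraph hSfin hSgen
  have hq := isQuasiconvexSubgroup_range_of hφ hSfin hS hU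
  exact ⟨hq, fun i => isHyperbolicGroup_of_isQuasiconvexSubgroup hSfin hS _
    (Monoid.PushoutI.of_injective hφ i) (hq i)⟩
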